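/- All spaces are real. Let $X,Y$ be Banach lattices, $E,F$ Banach spaces, $1\le q\le p\le\infty$, and let $p^*,q^*$ be the conjugate exponents. Dual spaces of Banach lattices carry the dual order ($\varphi\ge 0$ iff $\varphi(x)\ge 0$ for all $x\ge 0$), under which they are Banach lattices; $T^*$ denotes the Banach space adjoint. For finite sequences put $\|(x_i)\|_q=(\sum_i\|x_i\|^q)^{1/q}$ (the maximum if $q=\infty$), $\|(x_i)\|_{q,\omega}=\sup_{\|\varphi\|\le 1}\|(\varphi(x_i))_i\|_q$ and, in a Banach lattice, with $\varphi$ ranging over its dual, $\|(x_i)\|_{q,|\omega|}=\sup_{\varphi\ge0,\ \|\varphi\|\le1}\|(\varphi(|x_i|))_i\|_q$ and $\|(x_i)\|_{\ell_p^\pi}=\sup\{\sum_i\varphi_i(|x_i|):\varphi_i\ge 0,\ \|(\varphi_i)\|_{p^*,|\omega|}\le 1\}$. A bounded operator $T:X\to F$ is *positive $(p,q)$-summing*, $T\in\Lambda_{p,q}(X,F)$, if for some $C>0$ and all finite sequences $(x_i)$ in $X$ $$\|(Tx_i)\|_p\le C\,\|(x_i)\|_{q,|\omega|}.\qquad (a)$$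 Let $\|T\|_{\Lambda_{p,q}}$ be the infimum of the constants $C>0$ in (a), and $\|T\|_{\Lambda_{p,q}}^{+}$ the infimum of the constants $C>0$ for which (a) holds for all finite sequences of positive elements $x_i\ge0$. A bounded operator $T:E\to Y$ is *positive strongly $(p,q)$-summing*, $T\in\mathcal D^+_{p,q}(E,Y)$, if for some $C>0$ and all finite sequences $(x_i)_{i=1}^n$ in $E$ and $(y_i^*)_{i=1}^n$ of positive elements of $Y^*$ $$\sum_i|\langle Tx_i,y_i^*\rangle|\le C\,\|(x_i)\|_q\,\|(y_i^*)\|_{p^*,\omega}.\qquad (b)$$ Let $\|T\|_{\mathcal D^+_{p,q}}$ be the infimum of the constants $C>0$ in (b), and $\|T\|^{\pi}_{\mathcal D^+_{p,q}}$ the infimum of the constants $C>0$ such that $\|(Tx_i)\|_{\ell_p^\pi}\le C\|(x_i)\|_q$ for all finite sequences in $E$. All these infima are taken in $[0,\infty]$, with $\inf\emptyset=\infty$. **Theorem.** (1) For every bounded operator $T:X\to F$: $T\in\Lambda_{p,q}(X,F)$ if and only if $T^*\in\mathcal D^+_{q^*,p^*}(F^*,X^*)$. Moreover $\|T\|_{\Lambda_{p,q}}=\|T^*\|^{\pi}_{\mathcal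 D^+_{q^*,p^*}}$ and $\|T\|^{+}_{\Lambda_{p,q}}=\|T^*\|_{\mathcal D^+_{q^*,p^*}}$. (2) For every bounded operator $T:E\to Y$: $T\in\mathcal D^+_{p,q}(E,Y)$ if and only if $T^*\in\Lambda_{q^*,p^*}(Y^*,E^*)$. Moreover $\|T\|^{\pi}_{\mathcal D^+_{p,q}}=\|T^*\|_{\Lambda_{q^*,p^*}}$ and $\|T\|_{\mathcal D^+_{p,q}}=\|T^*\|^{+}_{\Lambda_{q^*,p^*}}$. -/

import Mathlib

open scoped ENNReal

noncomputable section

/-! ### The dual of a normed vector lattice as a normed vector lattice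

The order on the topological dual is `φ ≤ ψ` iff `φ x ≤ ψ x` for all `x ≥ 0`; the lattice operations
are given by the Riesz–Kantorovich formula. -/

namespace BanachLatticeDual

variable {X : Type*} [NormedAddCommGroup X] [Lattice X] [IsOrderedAddMonoid X]
  [NormedSpace ℝ X] [IsOrderedModule ℝ X] [HasSolidNorm X]

instance instPartialOrder : PartialOrder (StrongDual ℝ X) where
  le φ ψ := ∀ x : X, 0 ≤ x → φ x ≤ ψ x
  le_refl _ _ _ := le_rfl
  le_trans _ _ _ h₁ h₂ x hx := (h₁ x hx).trans (h₂ x hx)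
  le_antisymm φ ψ h₁ h₂ := by
    ext x
    have hp := le_antisymm (h₁ x⁺ (posPart_nonneg x)) (h₂ x⁺ (posPart_nonneg x))
    have hn := le_antisymm (h₁ x⁻ (negPart_nonneg x)) (h₂ x⁻ (negPart_nonneg x))
    rw [← posPart_sub_negPart x, map_sub, map_sub, hp, hn]

lemma le_iff (φ ψ : StrongDual ℝ X) : φ ≤ ψ ↔ ∀ x : X, 0 ≤ x → φ x ≤ ψ x := Iff.rfl

lemma norm_le_of_le {x y : X} (hx : 0 ≤ x) (hxy : x ≤ y) : ‖x‖ ≤ ‖y‖ :=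
  HasSolidNorm.solid (by rwa [abs_of_nonneg hx, abs_of_nonneg (hx.trans hxy)])

/-- `posSup φ x = sup {φ z : 0 ≤ z ≤ x}`, used for `x ≥ 0`. -/
def posSup (φ : StrongDual ℝ X) (x : X) : ℝ := sSup (φ '' Set.Icc 0 x)

lemma bddAbove_posSup (φ : StrongDual ℝ X) (x : X) : BddAbove (φ '' Set.Icc 0 x) := by
  refine ⟨‖φ‖ * ‖x‖, ?_⟩
  rintro _ ⟨z, hz, rfl⟩
  exact ((le_abs_self _).trans (φ.le_opNorm z)).trans
    (mul_le_mul_of_nonneg_left (norm_le_of_le hz.1 hz.2) (norm_nonneg _))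

lemma le_posSup (φ : StrongDual ℝ X) {x z : X} (h0 : 0 ≤ z) (hz : z ≤ x) : φ z ≤ posSup φ x :=
  le_csSup (bddAbove_posSup φ x) ⟨z, ⟨h0, hz⟩, rfl⟩

lemma posSup_le (φ : StrongDual ℝ X) {x : X} (hx : 0 ≤ x) {c : ℝ}
    (h : ∀ z, 0 ≤ z → z ≤ x → φ z ≤ c) : posSup φ x ≤ c := by
  refine csSup_le ⟨φ 0, 0, ⟨le_rfl, hx⟩, rfl⟩ ?_
  rintro _ ⟨z, hz, rfl⟩
  exact h z hz.1 hz.2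

lemma posSup_nonneg (φ : StrongDual ℝ X) {x : X} (hx : 0 ≤ x) : 0 ≤ posSup φ x := by
  simpa using le_posSup φ le_rfl hx

lemma posSup_add (φ : StrongDual ℝ X) {x y : X} (hx : 0 ≤ x) (hy : 0 ≤ y) :
    posSup φ (x + y) = posSup φ x + posSup φ y := by
  apply le_antisymm
  · refine posSup_le φ (add_nonneg hx hy) fun z h0 hz => ?_
    have h1 : φ (z ⊓ x) ≤ posSup φ x := le_posSup φ (le_inf h0 hx) inf_le_right
    have h2 : φ (z - z ⊓ x) ≤ posSup φ y := by
      refine le_posSup φ (sub_nonneg.2 inf_le_left) ?_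
      have h3 : z - y ≤ z ⊓ x := le_inf (sub_le_self z hy) (sub_le_iff_le_add.2 hz)
      exact sub_le_comm.1 h3
    have h4 : φ z = φ (z ⊓ x) + φ (z - z ⊓ x) := by rw [← map_add, add_sub_cancel]
    linarith
  · rw [← le_sub_iff_add_le]
    refine posSup_le φ hx fun z h0 hz => ?_
    rw [le_sub_comm]
    refine posSup_le φ hy fun w w0 hw => ?_
    rw [le_sub_iff_add_le, ← map_add]
    exact le_posSup φ (add_nonneg w0 h0) ((add_comm w z).le.trans (add_le_add hz hw))

/-- The additive extension of `posSup φ` to the whole space. -/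
def posHom (φ : StrongDual ℝ X) : X →+ ℝ :=
  AddMonoidHom.mk' (fun x => posSup φ x⁺ - posSup φ x⁻) fun x y => by
    have h : (x + y)⁺ + (x⁻ + y⁻) = x⁺ + y⁺ + (x + y)⁻ := by
      have h1 := posPart_sub_negPart (x + y)
      have h2 := posPart_sub_negPart x
      have h3 := posPart_sub_negPart y
      rw [← sub_eq_sub_iff_add_eq_add, h1, add_sub_add_comm, h2, h3]
    have h' := congrArg (posSup φ) h
    have hn : ∀ z : X, 0 ≤ z⁻ := negPart_nonneg
    have hp : ∀ z : X, 0 ≤ z⁺ := posPart_nonneg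
    rw [posSup_add φ (hp _) (add_nonneg (hn _) (hn _)), posSup_add φ (hn _) (hn _),
      posSup_add φ (add_nonneg (hp _) (hp _)) (hn _), posSup_add φ (hp _) (hp _)] at h'
    linarith

lemma posHom_of_nonneg (φ : StrongDual ℝ X) {x : X} (hx : 0 ≤ x) : posHom φ x = posSup φ x := by
  have h0 : posSup φ (0 : X) = 0 := by
    have := posSup_add φ (le_refl (0 : X)) le_rfl
    rw [add_zero] at this
    linarith
  change posSup φ x⁺ - posSup φ x⁻ = _
  rw [posPart_of_nonneg hx, negPart_of_nonneg hx, h0, sub_zero]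

lemma continuous_posHom (φ : StrongDual ℝ X) : Continuous (posHom φ) := by
  refine AddMonoidHomClass.continuous_of_bound (posHom φ) ‖φ‖ fun x => ?_
  have key : ∀ y : X, 0 ≤ y → y ≤ |x| → posSup φ y ≤ ‖φ‖ * ‖x‖ := fun y hy hyx => by
    refine posSup_le φ hy fun z h0 hz => ?_
    refine ((le_abs_self _).trans (φ.le_opNorm z)).trans
      (mul_le_mul_of_nonneg_left ?_ (norm_nonneg _))
    rw [← norm_abs_eq_norm x]
    exact norm_le_of_le h0 (hz.trans hyx)
  have hp : x⁺ ≤ |x| := sup_le (le_abs_self x) (abs_nonneg x)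
  have hn : x⁻ ≤ |x| := sup_le (neg_le_abs x) (abs_nonneg x)
  have a1 := key _ (posPart_nonneg x) hp
  have a2 := key _ (negPart_nonneg x) hn
  have b1 := posSup_nonneg φ (posPart_nonneg x)
  have b2 := posSup_nonneg φ (negPart_nonneg x)
  change |posSup φ x⁺ - posSup φ x⁻| ≤ _
  rw [abs_le]
  constructor <;> linarith

/-- The positive part of a continuous functional, `φ⁺ x = sup {φ z : 0 ≤ z ≤ x}` for `x ≥ 0`. -/
def pos (φ : StrongDual ℝ X) : StrongDual ℝ X :=
  (posHom φ).toRealLinearMap (continuous_posHom φ)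

lemma pos_apply (φ : StrongDual ℝ X) {x : X} (hx : 0 ≤ x) : pos φ x = posSup φ x :=
  posHom_of_nonneg φ hx

instance instLattice : Lattice (StrongDual ℝ X) where
  sup φ ψ := φ + pos (ψ - φ)
  inf φ ψ := φ - pos (φ - ψ)
  le_sup_left φ ψ x hx := by
    have := posSup_nonneg (ψ - φ) hx
    simpa [pos_apply _ hx] using this
  le_sup_right φ ψ x hx := by
    have := le_posSup (ψ - φ) hx le_rfl
    simp only [_root_.sub_apply] at this
    simp only [_root_.add_apply, pos_apply _ hx]
    linarith
  sup_le φ ψ χ h1 h2 x hx := by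
    have : posSup (ψ - φ) x ≤ χ x - φ x := by
      refine posSup_le _ hx fun z h0 hz => ?_
      have a := h2 z h0
      have b := h1 (x - z) (sub_nonneg.2 hz)
      simp only [map_sub] at b
      simp only [_root_.sub_apply]
      linarith
    simp only [_root_.add_apply, pos_apply _ hx]
    linarith
  inf_le_left φ ψ x hx := by
    have := posSup_nonneg (φ - ψ) hx
    simpa [pos_apply _ hx] using this
  inf_le_right φ ψ x hx := by
    have := le_posSup (φ - ψ) hx le_rfl
    simp only [_root_.sub_apply] at this
    simp only [_root_.sub_apply, pos_apply _ hx]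
    linarith
  le_inf χ φ ψ h1 h2 x hx := by
    have : posSup (φ - ψ) x ≤ φ x - χ x := by
      refine posSup_le _ hx fun z h0 hz => ?_
      have a := h2 z h0
      have b := h1 (x - z) (sub_nonneg.2 hz)
      simp only [map_sub] at b
      simp only [_root_.sub_apply]
      linarith
    simp only [_root_.sub_apply, pos_apply _ hx]
    linarith

instance instIsOrderedAddMonoid : IsOrderedAddMonoid (StrongDual ℝ X) where
  add_le_add_left φ ψ h χ x hx := by
    simpa using h x hx

instance instIsOrderedModule : IsOrderedModule ℝ (StrongDual ℝ X) where
  smul_le_smul_of_nonneg_left r hr φ ψ h x hx := by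
    simpa using mul_le_mul_of_nonneg_left (h x hx) hr
  smul_le_smul_of_nonneg_right φ hφ r s h x hx := by
    have h0 : (0 : ℝ) ≤ φ x := by simpa using hφ x hx
    simpa using mul_le_mul_of_nonneg_right h h0

lemma abs_apply_le (φ : StrongDual ℝ X) {x : X} (hx : 0 ≤ x) : |φ| x ≤ ‖φ‖ * ‖x‖ := by
  change (φ + pos (-φ - φ)) x ≤ _
  rw [_root_.add_apply, pos_apply _ hx, ← le_sub_iff_add_le']
  refine posSup_le _ hx fun z h0 hz => ?_
  have h1 : φ (x - z - z) ≤ ‖φ‖ * ‖x‖ := by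
    refine ((le_abs_self _).trans (φ.le_opNorm _)).trans
      (mul_le_mul_of_nonneg_left (HasSolidNorm.solid ?_) (norm_nonneg _))
    rw [abs_of_nonneg hx]
    refine abs_le'.2 ⟨?_, ?_⟩
    · exact (sub_le_self _ h0).trans (sub_le_self _ h0)
    · rw [neg_sub, sub_sub_eq_add_sub, sub_le_iff_le_add]
      exact add_le_add hz hz
  simp only [map_sub] at h1
  simp only [_root_.sub_apply, _root_.neg_apply]
  linarith

lemma abs_apply_le_abs (φ : StrongDual ℝ X) (x : X) : |φ x| ≤ |φ| |x| := by
  have h1 := fun y hy => (le_iff _ _).1 (le_abs_self φ) y hy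
  have h2 := fun y hy => (le_iff _ _).1 (neg_le_abs φ) y hy
  have p1 := h1 x⁺ (posPart_nonneg x)
  have p2 := h2 x⁺ (posPart_nonneg x)
  have n1 := h1 x⁻ (negPart_nonneg x)
  have n2 := h2 x⁻ (negPart_nonneg x)
  have hx : φ x = φ x⁺ - φ x⁻ := by rw [← map_sub, posPart_sub_negPart]
  have ha : |φ| |x| = |φ| x⁺ + |φ| x⁻ := by rw [← map_add, posPart_add_negPart]
  simp only [_root_.neg_apply] at p2 n2
  rw [hx, ha, abs_le]
  constructor <;> linarith

instance instHasSolidNorm : HasSolidNorm (StrongDual ℝ X) where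
  solid φ ψ h := by
    refine φ.opNorm_le_bound (norm_nonneg _) fun x => ?_
    calc ‖φ x‖ ≤ |φ| |x| := abs_apply_le_abs φ x
      _ ≤ |ψ| |x| := (le_iff _ _).1 h _ (abs_nonneg x)
      _ ≤ ‖ψ‖ * ‖|x|‖ := abs_apply_le ψ (abs_nonneg x)
      _ = ‖ψ‖ * ‖x‖ := by rw [norm_abs_eq_norm]

end BanachLatticeDual

/-! ### Norms of finite sequences -/

section SequenceNorms

/-- The norm of `ℓ_p(E)`: `(∑ ‖x i‖ ^ p) ^ (1 / p)`, and `max ‖x i‖` for `p = ∞`. -/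
def strongNorm {E : Type*} [NormedAddCommGroup E] (p : ℝ≥0∞) {n : ℕ} (x : Fin n → E) : ℝ :=
  ‖WithLp.toLp p x‖

/-- The norm of `ℓ_{p,ω}(E)`: the supremum of `‖(φ (x i))‖_p` over the closed unit ball of the
dual of `E`. -/
def weakNorm {E : Type*} [NormedAddCommGroup E] [NormedSpace ℝ E] (p : ℝ≥0∞) {n : ℕ}
    (x : Fin n → E) : ℝ :=
  ⨆ φ : {φ : StrongDual ℝ E // ‖φ‖ ≤ 1}, strongNorm p fun i => φ.1 (x i)

variable {X : Type*} [NormedAddCommGroup X] [Lattice X] [IsOrderedAddMonoid X]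
  [NormedSpace ℝ X] [IsOrderedModule ℝ X] [HasSolidNorm X]

/-- The norm of `ℓ_{p,|ω|}(X)`: the supremum of `‖(φ |x i|)‖_p` over the positive part of the closed
unit ball of the dual of `X`. -/
def absWeakNorm (p : ℝ≥0∞) {n : ℕ} (x : Fin n → X) : ℝ :=
  ⨆ φ : {φ : StrongDual ℝ X // 0 ≤ φ ∧ ‖φ‖ ≤ 1}, strongNorm p fun i => φ.1 |x i|

/-- The norm of `ℓ_p^π(X)`: the supremum of `∑ φ i |x i|` over the positive elements `φ` of the closed
unit ball of `ℓ_{p*,|ω|}(X*)`. -/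
def piNorm (p : ℝ≥0∞) {n : ℕ} (x : Fin n → X) : ℝ :=
  ⨆ φ : {φ : Fin n → StrongDual ℝ X // (∀ i, 0 ≤ φ i) ∧ absWeakNorm p.conjExponent φ ≤ 1},
    ∑ i, φ.1 i |x i|

end SequenceNorms

/-! ### Positive summing and positive strongly summing operators -/

section Summing

variable {X : Type*} [NormedAddCommGroup X] [Lattice X] [IsOrderedAddMonoid X]
  [NormedSpace ℝ X] [IsOrderedModule ℝ X] [HasSolidNorm X]
  {E : Type*} [NormedAddCommGroup E] [NormedSpace ℝ E]

/-- `C` is an admissible constant for `T` as a positive `(p, q)`-summing operator, with arbitrary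
finite sequences in `X` as test sequences. -/
def PosSummingWith (p q : ℝ≥0∞) (T : X →L[ℝ] E) (C : ℝ) : Prop :=
  ∀ (n : ℕ) (x : Fin n → X), strongNorm p (fun i => T (x i)) ≤ C * absWeakNorm q x

/-- The same with finite sequences of positive elements of `X` only. -/
def PosSummingOnConeWith (p q : ℝ≥0∞) (T : X →L[ℝ] E) (C : ℝ) : Prop :=
  ∀ (n : ℕ) (x : Fin n → X), (∀ i, 0 ≤ x i) →
    strongNorm p (fun i => T (x i)) ≤ C * absWeakNorm q x

/-- `C` is an admissible constant for `T` as a positive strongly `(p, q)`-summing operator. -/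
def PosStronglySummingWith (p q : ℝ≥0∞) (T : E →L[ℝ] X) (C : ℝ) : Prop :=
  ∀ (n : ℕ) (x : Fin n → E) (φ : Fin n → StrongDual ℝ X), (∀ i, 0 ≤ φ i) →
    ∑ i, |φ i (T (x i))| ≤ C * strongNorm q x * weakNorm p.conjExponent φ

/-- `C` bounds `(x i) ↦ (T (x i))` from `ℓ_q(E)` to `ℓ_p^π(X)` on finite sequences. -/
def PiBoundedWith (p q : ℝ≥0∞) (T : E →L[ℝ] X) (C : ℝ) : Prop :=
  ∀ (n : ℕ) (x : Fin n → E), piNorm p (fun i => T (x i)) ≤ C * strongNorm q x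

/-- The class `Λ_{p,q}(X, E)`. -/
def IsPosSumming (p q : ℝ≥0∞) (T : X →L[ℝ] E) : Prop :=
  ∃ C : ℝ, 0 < C ∧ PosSummingWith p q T C

/-- The class `D⁺_{p,q}(E, X)`. -/
def IsPosStronglySumming (p q : ℝ≥0∞) (T : E →L[ℝ] X) : Prop :=
  ∃ C : ℝ, 0 < C ∧ PosStronglySummingWith p q T C

/-- The infimum in `[0, ∞]` of the positive constants with a given property; it is `∞` exactly when
there is no such constant. -/
def leastConstant (P : ℝ → Prop) : ℝ≥0∞ := ⨅ (C : ℝ) (_ : 0 < C ∧ P C), ENNReal.ofReal C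

def posSummingNorm (p q : ℝ≥0∞) (T : X →L[ℝ] E) : ℝ≥0∞ :=
  leastConstant (PosSummingWith p q T)

def posSummingConeNorm (p q : ℝ≥0∞) (T : X →L[ℝ] E) : ℝ≥0∞ :=
  leastConstant (PosSummingOnConeWith p q T)

def posStronglySummingNorm (p q : ℝ≥0∞) (T : E →L[ℝ] X) : ℝ≥0∞ :=
  leastConstant (PosStronglySummingWith p q T)

def posStronglySummingPiNorm (p q : ℝ≥0∞) (T : E →L[ℝ] X) : ℝ≥0∞ :=
  leastConstant (PiBoundedWith p q T)

end Summing

/-- The Banach space adjoint `T* φ = φ ∘ T`. -/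
def dualOperator {E F : Type*} [NormedAddCommGroup E] [NormedSpace ℝ E] [NormedAddCommGroup F]
    [NormedSpace ℝ F] (T : E →L[ℝ] F) : StrongDual ℝ F →L[ℝ] StrongDual ℝ E :=
  ContinuousLinearMap.precomp ℝ T

end

/-!
All four equalities of constants come from equivalences that hold for each single constant `C`; the
conjugate exponents enter through the duality between `ℓ_p(E)` and `ℓ_{p*}(E*)` on finite sequences
(`strongNorm_le_of_forall_dual`, `strongNorm_dual_le_of_forall`). The membership statements follow
because a bound on the positive cone gives a bound on the whole lattice with twice the constant,
by `x = x⁺ - x⁻`.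

For `T : E → Y` the two sides test the same pairing `∑ φ i (T (x i))`. What is needed for the
`π`-norm is that `φ |y|` is attained as `ψ y` with `|ψ| ≤ φ` (`exists_abs_le_apply_eq`).

For `T : X → F` one direction tests the adjoint on the canonical images of `x i` in the bidual. The
other direction has to extend an inequality `∑ g i (x i) ≤ C ‖(x i)‖_{q,|ω|}`, known for `x i ≥ 0`
in `X`, to positive elements `Φ i` of the bidual (`sum_bidual_apply_le`). No form of local
reflexivity is used: on nonnegative sequences, and up to a factor close to `1`, the norm of `ℓ_q^n`
is the maximum of finitely many functionals `a k ≥ 0` in the unit ball of `ℓ_{q*}^n`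
(`exists_finite_norming`), so that `∑ g i (x i) ≤ D max_k ‖∑ a k i • x i‖` for `x i ≥ 0`, with `D`
close to `C`. The Mazur–Orlicz theorem turns this into `g i ≤ ∑ a k i • φ k` with positive `φ k`
satisfying `∑ ‖φ k‖ ≤ D` (`exists_dominating_dual`). This is a finite relation in `X*`, hence
preserved by the `Φ i`, and for each `k` the sum over `i` of `a k i * Φ i (φ k)` is at most
`‖φ k‖ ‖(Φ i)‖_{q,|ω|}` by Hölder's inequality.
-/

set_option linter.unusedSectionVars false

/-! ### Duality for norms of finite sequences -/

section StrongNorm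

variable {E : Type*} [NormedAddCommGroup E] {G : Type*} [NormedAddCommGroup G]
  {p r : ℝ≥0∞} {n : ℕ}

lemma strongNorm_one (x : Fin n → E) : strongNorm 1 x = ∑ i, ‖x i‖ := by
  simp [strongNorm, PiLp.norm_eq_sum (p := 1) (by simp)]

lemma strongNorm_top (x : Fin n → E) : strongNorm ∞ x = ⨆ i, ‖x i‖ := rfl

lemma strongNorm_eq_sum (hp : 0 < p.toReal) (x : Fin n → E) :
    strongNorm p x = (∑ i, ‖x i‖ ^ p.toReal) ^ (1 / p.toReal) :=
  PiLp.norm_eq_sum hp _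

lemma strongNorm_nonneg (hp : 1 ≤ p) (x : Fin n → E) : 0 ≤ strongNorm p x :=
  haveI : Fact (1 ≤ p) := ⟨hp⟩
  norm_nonneg _

lemma norm_le_strongNorm (hp : 1 ≤ p) (x : Fin n → E) (i : Fin n) : ‖x i‖ ≤ strongNorm p x :=
  haveI : Fact (1 ≤ p) := ⟨hp⟩
  PiLp.norm_apply_le (WithLp.toLp p x) i

lemma strongNorm_smul [NormedSpace ℝ E] (hp : 1 ≤ p) (c : ℝ) (x : Fin n → E) :
    strongNorm p (fun i => c • x i) = |c| * strongNorm p x :=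
  haveI : Fact (1 ≤ p) := ⟨hp⟩
  norm_smul c (WithLp.toLp p x)

lemma strongNorm_zero (hp : 1 ≤ p) : strongNorm p (fun _ : Fin n => (0 : E)) = 0 :=
  haveI : Fact (1 ≤ p) := ⟨hp⟩
  norm_zero (E := PiLp p fun _ : Fin n => E)

lemma strongNorm_sub_le (hp : 1 ≤ p) (x y : Fin n → E) :
    strongNorm p (fun i => x i - y i) ≤ strongNorm p x + strongNorm p y :=
  haveI : Fact (1 ≤ p) := ⟨hp⟩
  norm_sub_le (WithLp.toLp p x) (WithLp.toLp p y)

/-- Hölder's inequality for conjugate exponents in `[1, ∞]`. -/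
lemma sum_norm_mul_norm_le (h : p.HolderConjugate r) (f : Fin n → G) (x : Fin n → E) :
    ∑ i, ‖f i‖ * ‖x i‖ ≤ strongNorm r f * strongNorm p x := by
  have hp1 : 1 ≤ p := h.one_le
  have hr1 : 1 ≤ r := h.symm.one_le
  rcases eq_or_ne p ∞ with rfl | hp
  · obtain rfl : r = 1 := by rw [h.conj_eq]; simp
    rw [strongNorm_one, Finset.sum_mul]
    gcongr
    exact norm_le_strongNorm hp1 x _
  rcases eq_or_ne r ∞ with rfl | hr
  · obtain rfl : p = 1 := by rw [h.symm.conj_eq]; simp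
    rw [strongNorm_one, Finset.mul_sum]
    gcongr
    exact norm_le_strongNorm hr1 f _
  have hc := ENNReal.HolderConjugate.toReal_of_ne_top hp hr
  rw [strongNorm_eq_sum hc.symm.pos, strongNorm_eq_sum hc.pos]
  exact Real.inner_le_Lp_mul_Lq_of_nonneg _ hc.symm (fun _ _ => norm_nonneg _)
    fun _ _ => norm_nonneg _

/-- Equality in Hölder's inequality is attained at a nonnegative scalar sequence. -/
lemma exists_sum_mul_norm_eq_strongNorm (h : p.HolderConjugate r) (x : Fin n → E) :
    ∃ a : Fin n → ℝ, (∀ i, 0 ≤ a i) ∧ strongNorm r a ≤ 1 ∧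
      ∑ i, a i * ‖x i‖ = strongNorm p x := by
  have hp1 : 1 ≤ p := h.one_le
  have hr1 : 1 ≤ r := h.symm.one_le
  rcases eq_or_ne p ∞ with rfl | hp
  · obtain rfl : r = 1 := by rw [h.conj_eq]; simp
    rcases isEmpty_or_nonempty (Fin n) with he | hne
    · exact ⟨0, by simp, by simp [strongNorm_one], by simp [strongNorm_top]⟩
    obtain ⟨j, hj⟩ := exists_eq_ciSup_of_finite (f := fun i => ‖x i‖)
    refine ⟨Pi.single j 1, fun i => ?_, ?_, ?_⟩
    · by_cases hij : i = j
      · subst hij; simp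
      · simp [hij]
    · rw [strongNorm_one, Finset.sum_eq_single j] <;> simp +contextual
    · rw [strongNorm_top, ← hj, Finset.sum_eq_single j] <;> simp +contextual
  rcases eq_or_ne r ∞ with rfl | hr
  · obtain rfl : p = 1 := by rw [h.symm.conj_eq]; simp
    refine ⟨fun _ => 1, by simp, ?_, by simp [strongNorm_one]⟩
    rw [strongNorm_top]
    exact Real.iSup_le (by simp) zero_le_one
  have hc := ENNReal.HolderConjugate.toReal_of_ne_top hp hr
  obtain ⟨a, ha, he⟩ := (NNReal.isGreatest_Lp Finset.univ (fun i => ‖x i‖₊) hc).1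
  refine ⟨fun i => a i, fun i => (a i).2, ?_, ?_⟩
  · rw [strongNorm_eq_sum hc.symm.pos]
    refine Real.rpow_le_one (by positivity) ?_ hc.symm.one_div_nonneg
    have : ((∑ i, a i ^ r.toReal : NNReal) : ℝ) ≤ 1 := by exact_mod_cast ha
    simpa using this
  · rw [strongNorm_eq_sum hc.pos]
    have := congrArg NNReal.toReal he
    push_cast at this
    simpa [mul_comm] using this

lemma strongNorm_mono (hp : 1 ≤ p) {x : Fin n → E} {y : Fin n → G} (hxy : ∀ i, ‖x i‖ ≤ ‖y i‖) :
    strongNorm p x ≤ strongNorm p y := by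
  have h := ENNReal.HolderConjugate.conjExponent hp
  obtain ⟨a, ha, ha1, hax⟩ := exists_sum_mul_norm_eq_strongNorm h x
  rw [← hax]
  calc ∑ i, a i * ‖x i‖ ≤ ∑ i, ‖a i‖ * ‖y i‖ := by
        gcongr with i
        · exact le_abs_self _
        · exact hxy i
    _ ≤ _ := sum_norm_mul_norm_le h a y
    _ ≤ 1 * strongNorm p y := by gcongr; exact strongNorm_nonneg hp y
    _ = _ := one_mul _

variable [NormedSpace ℝ E]

lemma sum_abs_apply_le (h : p.HolderConjugate r) (f : Fin n → StrongDual ℝ E) (x : Fin n → E) :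
    ∑ i, |f i (x i)| ≤ strongNorm r f * strongNorm p x :=
  (Finset.sum_le_sum fun i _ => (f i).le_opNorm (x i)).trans (sum_norm_mul_norm_le h f x)

/-- The norm of `ℓ_p(E)` is determined by the unit ball of `ℓ_{p*}(E*)`. -/
lemma strongNorm_le_of_forall_dual (h : p.HolderConjugate r) {x : Fin n → E} {c : ℝ}
    (hc : ∀ f : Fin n → StrongDual ℝ E, strongNorm r f ≤ 1 → ∑ i, f i (x i) ≤ c) :
    strongNorm p x ≤ c := by
  obtain ⟨a, ha, ha1, hax⟩ := exists_sum_mul_norm_eq_strongNorm h x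
  choose g hg hgx using fun i => exists_dual_vector'' ℝ (x i)
  rw [← hax]
  refine le_trans (le_of_eq ?_) (hc (fun i => a i • g i) ?_)
  · simp [hgx]
  · refine (strongNorm_mono h.symm.one_le fun i => ?_).trans ha1
    rw [norm_smul]
    exact mul_le_of_le_one_right (norm_nonneg _) (hg i)

/-- The norm of `ℓ_r(E*)` is determined by the unit ball of `ℓ_{r*}(E)`. -/
lemma strongNorm_dual_le_of_forall (h : p.HolderConjugate r) {f : Fin n → StrongDual ℝ E} {c : ℝ}
    (hc : ∀ x : Fin n → E, strongNorm p x ≤ 1 → ∑ i, f i (x i) ≤ c) :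
    strongNorm r f ≤ c := by
  -- Functionals need not attain their norms, so the extremal sequence is only approximated.
  obtain ⟨a, ha, ha1, haf⟩ := exists_sum_mul_norm_eq_strongNorm h.symm f
  rw [← haf]
  have hsum : ∀ ε : ℝ, 0 < ε → ∑ i, a i * ‖f i‖ ≤ c + (∑ i, a i) * ε := by
    intro ε hε
    have hx : ∀ i, ∃ x : E, ‖x‖ ≤ 1 ∧ ‖f i‖ - ε ≤ f i x := by
      intro i
      obtain ⟨x, hx1, hx⟩ := (f i).exists_lt_apply_of_lt_opNorm (sub_lt_self ‖f i‖ hε)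
      rcases le_total 0 (f i x) with h0 | h0
      · exact ⟨x, hx1.le, by rw [Real.norm_of_nonneg h0] at hx; exact hx.le⟩
      · exact ⟨-x, by simpa using hx1.le, by
          rw [Real.norm_of_nonpos h0] at hx; rw [map_neg]; exact hx.le⟩
    choose x hx1 hx using hx
    have h1 := hc (fun i => a i • x i) <| by
      refine (strongNorm_mono h.one_le fun i => ?_).trans ha1
      rw [norm_smul]
      exact mul_le_of_le_one_right (norm_nonneg _) (hx1 i)
    have h2 : ∑ i, a i * (‖f i‖ - ε) ≤ ∑ i, f i (a i • x i) := by
      refine Finset.sum_le_sum fun i _ => ?_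
      rw [map_smul, smul_eq_mul]
      exact mul_le_mul_of_nonneg_left (hx i) (ha i)
    simp only [mul_sub, Finset.sum_sub_distrib, ← Finset.sum_mul] at h2
    linarith
  have hs : 0 ≤ ∑ i, a i := Finset.sum_nonneg fun i _ => ha i
  refine le_of_forall_pos_le_add fun δ hδ => ?_
  refine (hsum (δ / (∑ i, a i + 1)) (by positivity)).trans ?_
  gcongr
  rw [mul_div_assoc', div_le_iff₀ (by positivity)]
  nlinarith

end StrongNorm

/-! ### Finite norming sets and the Mazur–Orlicz theorem -/

/-- A finite subset of the positive part of the unit ball of `ℓ_r^n` norms the positive cone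
of `ℓ_p^n` up to a factor arbitrarily close to `1`, for conjugate exponents `p` and `r`. -/
lemma exists_finite_norming {p r : ℝ≥0∞} (h : p.HolderConjugate r) (n : ℕ) {ε : ℝ} (hε : 0 < ε) :
    ∃ (m : ℕ) (a : Fin m → Fin n → ℝ), (∀ k i, 0 ≤ a k i) ∧ (∀ k, strongNorm r (a k) ≤ 1) ∧
      ∀ t : Fin n → ℝ, (∀ i, 0 ≤ t i) →
        ∃ k, (1 - ε) * strongNorm p t ≤ ∑ i, a k i * t i := by
  have hr := h.symm.one_le
  set B : Set (Fin n → ℝ) := {a | (∀ i, 0 ≤ a i) ∧ strongNorm r a ≤ 1} with hB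
  -- Coordinatewise errors `ε / (n + 1)` add up to at most `ε`.
  have hδ : (0 : ℝ) < ε / (n + 1) := by positivity
  have hbdd : Bornology.IsBounded B := by
    refine (Metric.isBounded_closedBall (x := (0 : Fin n → ℝ)) (r := 1)).subset fun a ha => ?_
    rw [mem_closedBall_zero_iff, pi_norm_le_iff_of_nonneg zero_le_one]
    exact fun i => (norm_le_strongNorm hr a i).trans ha.2
  obtain ⟨S, hSB, hS, hcov⟩ :=
    exists_finite_cover_balls_of_isCompact_closure hbdd.isCompact_closure hδ
  obtain ⟨m, s, rfl⟩ := hS.fin_embedding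
  refine ⟨m, s, fun k => (hSB ⟨k, rfl⟩).1, fun k => (hSB ⟨k, rfl⟩).2, fun t ht => ?_⟩
  obtain ⟨b, hb, hb1, hbt⟩ := exists_sum_mul_norm_eq_strongNorm h t
  obtain ⟨_, ⟨k, rfl⟩, hab⟩ := Set.mem_iUnion₂.1 (hcov (show b ∈ B from ⟨hb, hb1⟩))
  refine ⟨k, ?_⟩
  have key : ∑ i, (b i - s k i) * t i ≤ ∑ _i : Fin n, ε / (n + 1) * strongNorm p t := by
    refine Finset.sum_le_sum fun i _ => ?_
    refine mul_le_mul ?_ ?_ (ht i) hδ.le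
    · refine (le_abs_self _).trans ((norm_le_pi_norm (b - s k) i).trans ?_)
      rw [← dist_eq_norm]
      exact (Metric.mem_ball.1 hab).le
    · exact (le_abs_self _).trans (norm_le_strongNorm h.one_le t i)
  have hn : (n : ℝ) * (ε / (n + 1) * strongNorm p t) ≤ ε * strongNorm p t := by
    rw [← mul_assoc]
    refine mul_le_mul_of_nonneg_right ?_ (strongNorm_nonneg h.one_le t)
    rw [mul_div_assoc', div_le_iff₀ (by positivity)]
    nlinarith
  simp only [sub_mul, Finset.sum_sub_distrib, Finset.sum_const, Finset.card_univ,
    Fintype.card_fin, nsmul_eq_mul] at key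
  have hbt' : ∑ i, b i * t i = strongNorm p t := by
    rw [← hbt]
    exact Finset.sum_congr rfl fun i _ => by rw [Real.norm_of_nonneg (ht i)]
  linarith

/-- The **Mazur–Orlicz theorem** for an additive positively homogeneous comparison function on a
convex cone: if `g ≤ N ∘ L` on the cone, then some linear functional `Λ ≤ N` satisfies `g ≤ Λ ∘ L`
on the cone. -/
lemma exists_linear_le_sublinear_ge_on_cone {V W : Type*} [AddCommGroup V] [Module ℝ V]
    [AddCommGroup W] [Module ℝ W] (K : PointedCone ℝ V) (L : V →ₗ[ℝ] W) (g : V →ₗ[ℝ] ℝ) (N : W → ℝ)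
    (N_hom : ∀ c : ℝ, 0 < c → ∀ x, N (c • x) = c * N x) (N_add : ∀ x y, N (x + y) ≤ N x + N y)
    (hg : ∀ x ∈ K, g x ≤ N (L x)) :
    ∃ f : W →ₗ[ℝ] ℝ, (∀ y, f y ≤ N y) ∧ ∀ x ∈ K, g x ≤ f (L x) := by
  -- `S y = inf {N (y + L x) - g x : x ∈ K}` is sublinear, and every linear `f ≤ S` will do.
  set S : W → ℝ := fun y => ⨅ x : K, (N (y + L x) - g x) with hS
  have hbdd : ∀ y, BddBelow (Set.range fun x : K => N (y + L x) - g x) := by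
    refine fun y => ⟨-N (-y), ?_⟩
    rintro _ ⟨x, rfl⟩
    have h1 := N_add (y + L x) (-y)
    rw [add_neg_cancel_comm] at h1
    have h2 := hg x x.2
    dsimp only
    linarith
  have S_le : ∀ y (x : V), x ∈ K → S y ≤ N (y + L x) - g x := fun y x hx =>
    ciInf_le (hbdd y) ⟨x, hx⟩
  have S_hom_le : ∀ c : ℝ, 0 < c → ∀ y, c * S y ≤ S (c • y) := by
    refine fun c hc y => le_ciInf fun x => ?_
    have h1 := S_le y (c⁻¹ • (x : V)) (K.smul_mem (inv_pos.2 hc).le x.2)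
    have h2 : c • (y + L (c⁻¹ • (x : V))) = c • y + L x := by
      rw [smul_add, map_smul, smul_inv_smul₀ hc.ne']
    have h3 := N_hom c hc (y + L (c⁻¹ • (x : V)))
    rw [h2] at h3
    rw [h3]
    have h4 : g (x : V) = c * g (c⁻¹ • (x : V)) := by
      rw [map_smul, smul_eq_mul, mul_inv_cancel_left₀ hc.ne']
    rw [h4, ← mul_sub]
    exact mul_le_mul_of_nonneg_left h1 hc.le
  have S_hom : ∀ c : ℝ, 0 < c → ∀ y, S (c • y) = c * S y := by
    refine fun c hc y => le_antisymm ?_ (S_hom_le c hc y)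
    have := S_hom_le c⁻¹ (by positivity) (c • y)
    rwa [inv_smul_smul₀ hc.ne', inv_mul_le_iff₀ hc] at this
  have S_add : ∀ y z, S (y + z) ≤ S y + S z := by
    intro y z
    refine le_ciInf_add_ciInf fun x x' => ?_
    refine (S_le (y + z) (x + x') (K.add_mem x.2 x'.2)).trans ?_
    have := N_add (y + L x) (z + L x')
    rw [map_add, map_add, add_add_add_comm]
    linarith
  have S_zero : 0 ≤ S 0 := le_ciInf fun x => by
    have := hg x x.2
    rw [zero_add]
    linarith
  obtain ⟨f, -, hf⟩ := exists_extension_of_le_sublinear (⊥ : W →ₗ.[ℝ] ℝ) S S_hom S_add <| by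
    rintro ⟨x, hx⟩
    obtain rfl : x = 0 := (Submodule.mem_bot ℝ).1 hx
    refine le_trans (le_of_eq ?_) S_zero
    exact map_zero (⊥ : W →ₗ.[ℝ] ℝ).toFun
  refine ⟨f, fun y => (hf y).trans ?_, fun x hx => ?_⟩
  · simpa using S_le y 0 K.zero_mem
  · have N_zero : N 0 = 0 := by
      have := N_hom 2 two_pos 0
      rw [smul_zero] at this
      linarith
    have h1 := (hf (-L x)).trans (S_le (-L x) x hx)
    rw [neg_add_cancel, map_neg, N_zero] at h1
    linarith

section

open BanachLatticeDual

/-! ### Positive functionals and moduli of functionals -/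

section LatticeDual

variable {X : Type*} [NormedAddCommGroup X] [Lattice X] [IsOrderedAddMonoid X]
  [NormedSpace ℝ X] [IsOrderedModule ℝ X] [HasSolidNorm X]

lemma dual_apply_nonneg {φ : StrongDual ℝ X} (hφ : 0 ≤ φ) {x : X} (hx : 0 ≤ x) : 0 ≤ φ x := by
  simpa using hφ x hx

lemma dual_apply_mono {φ : StrongDual ℝ X} (hφ : 0 ≤ φ) {x y : X} (hxy : x ≤ y) : φ x ≤ φ y := by
  have := dual_apply_nonneg hφ (sub_nonneg.2 hxy)
  rwa [map_sub, sub_nonneg] at this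

lemma norm_pi_posPart_add_le {ι : Type*} [Fintype ι] (y z : ι → X) :
    ‖fun k => (y k + z k)⁺‖ ≤ ‖fun k => (y k)⁺‖ + ‖fun k => (z k)⁺‖ := by
  refine le_trans ?_ (norm_add_le _ _)
  rw [pi_norm_le_iff_of_nonneg (norm_nonneg _)]
  intro k
  refine le_trans ?_ (norm_le_pi_norm ((fun k => (y k)⁺) + fun k => (z k)⁺) k)
  refine norm_le_of_le (posPart_nonneg _) (sup_le ?_ ?_)
  · exact add_le_add le_sup_left le_sup_left
  · exact add_nonneg (posPart_nonneg _) (posPart_nonneg _)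

lemma posPart_smul_of_nonneg {c : ℝ} (hc : 0 ≤ c) (x : X) : (c • x)⁺ = c • x⁺ := by
  rcases hc.eq_or_lt with rfl | hc
  · simp
  have h : ∀ {d : ℝ}, 0 < d → ∀ y : X, (d • y)⁺ ≤ d • y⁺ := fun {d} hd y =>
    sup_le (smul_le_smul_of_nonneg_left le_sup_left hd.le) (smul_nonneg hd.le (posPart_nonneg y))
  refine le_antisymm (h hc x) ?_
  have h1 := smul_le_smul_of_nonneg_left (h (inv_pos.2 hc) (c • x)) hc.le
  rwa [inv_smul_smul₀ hc.ne', smul_inv_smul₀ hc.ne'] at h1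

lemma abs_smul_of_nonneg {c : ℝ} (hc : 0 ≤ c) (x : X) : |c • x| = c • |x| := by
  rw [← posPart_add_negPart, ← posPart_add_negPart x, smul_add, posPart_smul_of_nonneg hc,
    ← posPart_neg, ← posPart_neg x, ← smul_neg, posPart_smul_of_nonneg hc]

/-- For `φ ≥ 0` the value `φ |x|` is the maximum of `ψ x` over `|ψ| ≤ φ`. -/
lemma exists_abs_le_apply_eq {φ : StrongDual ℝ X} (hφ : 0 ≤ φ) (x : X) :
    ∃ ψ : StrongDual ℝ X, |ψ| ≤ φ ∧ φ |x| ≤ ψ x := by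
  -- Extend `r • x ↦ r * φ |x|` below the sublinear functional `y ↦ φ |y|`.
  obtain ⟨f, hf, hfx⟩ := exists_linear_le_sublinear_ge_on_cone (PointedCone.positive ℝ ℝ)
    (LinearMap.toSpanSingleton ℝ X x) (φ |x| • LinearMap.id) (fun y => φ |y|)
    (fun c hc y => by rw [abs_smul_of_nonneg hc.le, map_smul, smul_eq_mul])
    (fun y z => by rw [← map_add]; exact dual_apply_mono hφ (abs_add_le y z))
    (fun r hr => by
      have hr : 0 ≤ r := by simpa using hr
      simp [abs_smul_of_nonneg hr, mul_comm])
  have hbound : ∀ y, ‖f y‖ ≤ ‖φ‖ * ‖y‖ := by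
    intro y
    have h0 : φ |y| ≤ ‖φ‖ * ‖y‖ := by
      rw [← norm_abs_eq_norm y]
      exact (le_abs_self _).trans (φ.le_opNorm _)
    refine abs_le.2 ⟨?_, (hf y).trans h0⟩
    have := hf (-y)
    rw [map_neg, abs_neg] at this
    linarith
  refine ⟨f.mkContinuous ‖φ‖ hbound, abs_le'.2 ⟨fun y hy => ?_, fun y hy => ?_⟩, ?_⟩
  · simpa [abs_of_nonneg hy] using hf y
  · simpa [abs_of_nonneg hy] using hf (-y)
  · simpa using hfx 1 (by simp)

lemma inclusionInDoubleDual_nonneg {x : X} (hx : 0 ≤ x) :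
    0 ≤ NormedSpace.inclusionInDoubleDual ℝ X x := fun φ hφ => by
  simpa using dual_apply_nonneg hφ hx

/-- For `x ≥ 0` this is the nontrivial half of `|φ| x = sup {φ z : |z| ≤ x}`: if `0 ≤ w ≤ x` then
`z = x - 2 w` satisfies `|z| ≤ x`. -/
lemma abs_dual_apply_le {φ : StrongDual ℝ X} {x : X} (hx : 0 ≤ x) {c : ℝ}
    (h : ∀ z, |z| ≤ x → φ z ≤ c) : |φ| x ≤ c := by
  change (φ + pos (-φ - φ)) x ≤ _
  rw [_root_.add_apply, pos_apply _ hx, ← le_sub_iff_add_le']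
  refine posSup_le _ hx fun z h0 hz => ?_
  have h1 := h (x - z - z) <| abs_le'.2
    ⟨(sub_le_self _ h0).trans (sub_le_self _ h0), by
      rw [neg_sub, sub_sub_eq_add_sub, sub_le_iff_le_add]
      exact add_le_add hz hz⟩
  simp only [map_sub] at h1
  simp only [_root_.sub_apply, _root_.neg_apply]
  linarith

/-- The bound of `abs_dual_apply_le` simultaneously in finitely many coordinates: the suprema over
the `z i` can be taken independently. -/
lemma sum_abs_dual_apply_le {n : ℕ} {φ : Fin n → StrongDual ℝ X} {x : Fin n → X}
    (hx : ∀ i, 0 ≤ x i) {c : ℝ} (h : ∀ z : Fin n → X, (∀ i, |z i| ≤ x i) → ∑ i, φ i (z i) ≤ c) :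
    ∑ i, |φ i| (x i) ≤ c := by
  refine le_of_forall_pos_le_add fun ε hε => ?_
  have hδ : (0 : ℝ) < ε / (n + 1) := by positivity
  have hz : ∀ i, ∃ z, |z| ≤ x i ∧ |φ i| (x i) - ε / (n + 1) ≤ φ i z := by
    intro i
    by_contra! hcon
    have := abs_dual_apply_le (hx i) fun z hz => (hcon z hz).le
    linarith
  choose z hz hφz using hz
  have h1 := Finset.sum_le_sum fun i (_ : i ∈ Finset.univ) => hφz i
  have h2 := h z hz
  simp only [Finset.sum_sub_distrib, Finset.sum_const, Finset.card_univ, Fintype.card_fin,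
    nsmul_eq_mul] at h1
  have h3 : (n : ℝ) * (ε / (n + 1)) ≤ ε := by
    rw [mul_div_assoc', div_le_iff₀ (by positivity)]
    nlinarith
  linarith

end LatticeDual

/-! ### Weak norms and the `π`-norm -/

section WeakNorms

variable {X : Type*} [NormedAddCommGroup X] [Lattice X] [IsOrderedAddMonoid X]
  [NormedSpace ℝ X] [IsOrderedModule ℝ X] [HasSolidNorm X] {p q : ℝ≥0∞} {n : ℕ}

lemma strongNorm_apply_le_absWeakNorm_of_norm_le_one (hq : 1 ≤ q) {φ : StrongDual ℝ X}
    (hφ : 0 ≤ φ) (h1 : ‖φ‖ ≤ 1) (x : Fin n → X) :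
    strongNorm q (fun i => φ |x i|) ≤ absWeakNorm q x := by
  refine le_ciSup (f := fun φ : {φ : StrongDual ℝ X // 0 ≤ φ ∧ ‖φ‖ ≤ 1} =>
    strongNorm q fun i => φ.1 |x i|) ⟨strongNorm q x, ?_⟩ ⟨φ, hφ, h1⟩
  rintro _ ⟨ψ, rfl⟩
  refine strongNorm_mono hq fun i => ?_
  rw [← norm_abs_eq_norm (x i)]
  exact ψ.1.le_of_opNorm_le_of_le ψ.2.2 le_rfl |>.trans (one_mul _).le

lemma absWeakNorm_le {x : Fin n → X} {c : ℝ}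
    (h : ∀ φ : StrongDual ℝ X, 0 ≤ φ → ‖φ‖ ≤ 1 → strongNorm q (fun i => φ |x i|) ≤ c) :
    absWeakNorm q x ≤ c :=
  have : Nonempty {φ : StrongDual ℝ X // 0 ≤ φ ∧ ‖φ‖ ≤ 1} := ⟨⟨0, le_rfl, by simp⟩⟩
  ciSup_le fun φ => h φ.1 φ.2.1 φ.2.2

lemma absWeakNorm_nonneg (hq : 1 ≤ q) (x : Fin n → X) : 0 ≤ absWeakNorm q x :=
  (strongNorm_nonneg hq _).trans
    (strongNorm_apply_le_absWeakNorm_of_norm_le_one hq (φ := 0) le_rfl (by simp) x)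

lemma strongNorm_apply_le_norm_mul_absWeakNorm (hq : 1 ≤ q) {φ : StrongDual ℝ X} (hφ : 0 ≤ φ)
    (x : Fin n → X) : strongNorm q (fun i => φ |x i|) ≤ ‖φ‖ * absWeakNorm q x := by
  rcases eq_or_ne φ 0 with rfl | hne
  · simp [strongNorm_zero hq]
  have hpos : 0 < ‖φ‖ := norm_pos_iff.2 hne
  have h := strongNorm_apply_le_absWeakNorm_of_norm_le_one hq
    (smul_nonneg (inv_pos.2 hpos).le hφ)
    (by rw [norm_smul, norm_inv, norm_norm, inv_mul_cancel₀ hpos.ne']) x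
  have h2 := strongNorm_smul hq ‖φ‖⁻¹ fun i => φ |x i|
  rw [abs_of_pos (inv_pos.2 hpos)] at h2
  change strongNorm q (fun i => ‖φ‖⁻¹ • φ |x i|) ≤ _ at h
  rwa [h2, inv_mul_le_iff₀ hpos] at h

lemma absWeakNorm_mono (hq : 1 ≤ q) {x y : Fin n → X} (h : ∀ i, |x i| ≤ |y i|) :
    absWeakNorm q x ≤ absWeakNorm q y :=
  absWeakNorm_le fun φ hφ h1 =>
    (strongNorm_mono hq fun i => by
      rw [Real.norm_of_nonneg (dual_apply_nonneg hφ (abs_nonneg _)),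
        Real.norm_of_nonneg (dual_apply_nonneg hφ (abs_nonneg _))]
      exact dual_apply_mono hφ (h i)).trans
    (strongNorm_apply_le_absWeakNorm_of_norm_le_one hq hφ h1 y)

lemma absWeakNorm_smul_le (hq : 1 ≤ q) {c : ℝ} (hc : 0 ≤ c) (x : Fin n → X) :
    absWeakNorm q (fun i => c • x i) ≤ c * absWeakNorm q x := by
  refine absWeakNorm_le fun φ hφ h1 => ?_
  have h := strongNorm_smul hq c fun i => φ |x i|
  rw [abs_of_nonneg hc] at h
  simp only [abs_smul_of_nonneg hc, map_smul]
  rw [h]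
  exact mul_le_mul_of_nonneg_left
    (strongNorm_apply_le_absWeakNorm_of_norm_le_one hq hφ h1 x) hc

/-- The weak and the positive weak norm agree on sequences of positive elements. -/
lemma weakNorm_eq_absWeakNorm (hq : 1 ≤ q) {x : Fin n → X} (hx : ∀ i, 0 ≤ x i) :
    weakNorm q x = absWeakNorm q x := by
  have hle : ∀ φ : {φ : StrongDual ℝ X // ‖φ‖ ≤ 1},
      strongNorm q (fun i => φ.1 (x i)) ≤ absWeakNorm q x := by
    intro φ
    have h1 : ‖|φ.1|‖ ≤ 1 := by rw [norm_abs_eq_norm]; exact φ.2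
    refine (strongNorm_mono hq fun i => ?_).trans
      (strongNorm_apply_le_absWeakNorm_of_norm_le_one hq (abs_nonneg φ.1) h1 x)
    exact (abs_apply_le_abs φ.1 (x i)).trans (le_abs_self _)
  refine le_antisymm ?_ (absWeakNorm_le fun φ _ h1 => ?_)
  · have : Nonempty {φ : StrongDual ℝ X // ‖φ‖ ≤ 1} := ⟨⟨0, by simp⟩⟩
    exact ciSup_le hle
  · simp only [abs_of_nonneg (hx _)]
    exact le_ciSup (f := fun φ : {φ : StrongDual ℝ X // ‖φ‖ ≤ 1} =>
      strongNorm q fun i => φ.1 (x i)) ⟨_, Set.forall_mem_range.2 hle⟩ ⟨φ, h1⟩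

/-- A positive functional of norm at most one on the bidual restricts to one on `X`. -/
lemma absWeakNorm_inclusionInDoubleDual_le (hq : 1 ≤ q) {x : Fin n → X} (hx : ∀ i, 0 ≤ x i) :
    absWeakNorm q (fun i => NormedSpace.inclusionInDoubleDual ℝ X (x i)) ≤ absWeakNorm q x := by
  set J := NormedSpace.inclusionInDoubleDual ℝ X
  refine absWeakNorm_le fun Ψ hΨ h1 => ?_
  have hpos : 0 ≤ Ψ.comp J := fun y hy => by
    simpa using dual_apply_nonneg hΨ (inclusionInDoubleDual_nonneg hy)
  have hnorm : ‖Ψ.comp J‖ ≤ 1 := (Ψ.comp J).opNorm_le_bound zero_le_one fun y =>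
    Ψ.le_of_opNorm_le_of_le h1 (NormedSpace.double_dual_bound ℝ X y)
  have h := strongNorm_apply_le_absWeakNorm_of_norm_le_one hq hpos hnorm x
  have habs : ∀ i, |J (x i)| = J (x i) := fun i =>
    abs_of_nonneg (inclusionInDoubleDual_nonneg (hx i))
  simpa [abs_of_nonneg (hx _), habs] using h

lemma strongNorm_dual_apply_le (hq : 1 ≤ q) {φ : Fin n → StrongDual ℝ X} (hφ : ∀ i, 0 ≤ φ i)
    {x : X} (hx : 0 ≤ x) : strongNorm q (fun i => φ i x) ≤ ‖x‖ * absWeakNorm q φ := by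
  have h := strongNorm_apply_le_norm_mul_absWeakNorm hq (inclusionInDoubleDual_nonneg hx) φ
  simp only [abs_of_nonneg (hφ _), NormedSpace.dual_def] at h
  refine h.trans ?_
  gcongr
  · exact absWeakNorm_nonneg hq φ
  · exact NormedSpace.double_dual_bound ℝ X x

lemma dual_apply_abs_le (hq : 1 ≤ q) {φ : Fin n → StrongDual ℝ X} (hφ : ∀ i, 0 ≤ φ i)
    (i : Fin n) (x : X) : φ i |x| ≤ ‖x‖ * absWeakNorm q φ := by
  rw [← norm_abs_eq_norm x]
  exact (le_abs_self _).trans ((norm_le_strongNorm hq (fun i => φ i |x|) i).trans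
    (strongNorm_dual_apply_le hq hφ (abs_nonneg x)))

/-- The supremum defining `piNorm` is over a bounded set, since positive sequences in the unit ball
of `ℓ_{r,|ω|}(X*)` have entries of norm at most `1`. -/
lemma sum_apply_le_piNorm {r : ℝ≥0∞} (hr : p.conjExponent = r) (h1 : 1 ≤ r) (x : Fin n → X)
    {φ : Fin n → StrongDual ℝ X} (hφ : ∀ i, 0 ≤ φ i) (hφ1 : absWeakNorm r φ ≤ 1) :
    ∑ i, φ i |x i| ≤ piNorm p x := by
  subst hr
  refine le_ciSup (f := fun φ : {φ : Fin n → StrongDual ℝ X //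
    (∀ i, 0 ≤ φ i) ∧ absWeakNorm p.conjExponent φ ≤ 1} => ∑ i, φ.1 i |x i|)
    ⟨∑ i, ‖x i‖, ?_⟩ ⟨φ, hφ, hφ1⟩
  rintro _ ⟨ψ, rfl⟩
  refine Finset.sum_le_sum fun i _ => ?_
  exact (dual_apply_abs_le h1 ψ.2.1 i (x i)).trans (mul_le_of_le_one_right (norm_nonneg _) ψ.2.2)

lemma piNorm_le {r : ℝ≥0∞} (hr : p.conjExponent = r) (h1 : 1 ≤ r) {x : Fin n → X} {c : ℝ}
    (h : ∀ φ : Fin n → StrongDual ℝ X, (∀ i, 0 ≤ φ i) → absWeakNorm r φ ≤ 1 →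
      ∑ i, φ i |x i| ≤ c) : piNorm p x ≤ c := by
  subst hr
  have : Nonempty {φ : Fin n → StrongDual ℝ X //
      (∀ i, 0 ≤ φ i) ∧ absWeakNorm p.conjExponent φ ≤ 1} :=
    ⟨⟨0, fun _ => le_rfl, absWeakNorm_le fun Φ _ _ => by simp [strongNorm_zero h1]⟩⟩
  exact ciSup_le fun φ => h φ.1 φ.2.1 φ.2.2

lemma sum_apply_le_absWeakNorm_mul_piNorm {r : ℝ≥0∞} (hr : p.conjExponent = r) (h1 : 1 ≤ r)
    (x : Fin n → X) {φ : Fin n → StrongDual ℝ X} (hφ : ∀ i, 0 ≤ φ i) :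
    ∑ i, φ i |x i| ≤ absWeakNorm r φ * piNorm p x := by
  rcases (absWeakNorm_nonneg h1 φ).eq_or_lt with h0 | hc
  · rw [← h0, zero_mul]
    exact Finset.sum_nonpos fun i _ => by
      simpa [← h0] using dual_apply_abs_le h1 hφ i (x i)
  have h := sum_apply_le_piNorm hr h1 x (fun i => smul_nonneg (inv_pos.2 hc).le (hφ i))
    ((absWeakNorm_smul_le h1 (inv_pos.2 hc).le φ).trans (inv_mul_cancel₀ hc.ne').le)
  have h2 : ∑ i, ((absWeakNorm r φ)⁻¹ • φ i) |x i| = (absWeakNorm r φ)⁻¹ * ∑ i, φ i |x i| := by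
    simp [Finset.mul_sum]
  rwa [h2, inv_mul_le_iff₀ hc] at h

end WeakNorms

/-! ### Passing to the bidual -/

section Bidual

variable {X : Type*} [NormedAddCommGroup X] [Lattice X] [IsOrderedAddMonoid X]
  [NormedSpace ℝ X] [IsOrderedModule ℝ X] [HasSolidNorm X] {q r : ℝ≥0∞} {n m : ℕ}

/-- If `x ↦ ∑ g i (x i)` is bounded on the cone of `X ^ n` by `D` times the maximum of finitely many
expressions `‖(∑ a k i • x i)⁺‖`, then `g i ≤ ∑ a k i • φ k` for positive functionals `φ k` of total
norm at most `D`. The positive part in the bound is what makes the `φ k` positive. -/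
lemma exists_dominating_dual {a : Fin m → Fin n → ℝ} {g : Fin n → StrongDual ℝ X} {D : ℝ}
    (hD : 0 ≤ D) (hg : ∀ x : Fin n → X, (∀ i, 0 ≤ x i) →
      ∑ i, g i (x i) ≤ D * ‖fun k => (∑ i, a k i • x i)⁺‖) :
    ∃ φ : Fin m → StrongDual ℝ X, (∀ k, 0 ≤ φ k) ∧ ∑ k, ‖φ k‖ ≤ D ∧
      ∀ i, g i ≤ ∑ k, a k i • φ k := by
  obtain ⟨f, hf, hfg⟩ := exists_linear_le_sublinear_ge_on_cone
    (PointedCone.positive ℝ (Fin n → X))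
    (LinearMap.pi fun k : Fin m => ∑ i, a k i • (LinearMap.proj i : (Fin n → X) →ₗ[ℝ] X))
    (∑ i, (g i).toLinearMap ∘ₗ LinearMap.proj i)
    (fun y : Fin m → X => D * ‖fun k => (y k)⁺‖)
    (fun c hc y => by
      have : (fun k => ((c • y) k)⁺) = c • fun k => (y k)⁺ :=
        funext fun k => posPart_smul_of_nonneg hc.le (y k)
      rw [this, norm_smul, Real.norm_of_nonneg hc.le, mul_left_comm])
    (fun y z => by
      rw [← mul_add]
      exact mul_le_mul_of_nonneg_left (norm_pi_posPart_add_le y z) hD)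
    (fun x hx => by
      have hx : ∀ i, 0 ≤ x i := by simpa [Pi.le_def] using hx
      simpa using hg x hx)
  have hpos_le : ∀ y : Fin m → X, ∀ c : ℝ, 0 ≤ c → (∀ k, ‖y k‖ ≤ c) → f y ≤ D * c := by
    intro y c hc hy
    refine (hf y).trans (mul_le_mul_of_nonneg_left ?_ hD)
    refine (pi_norm_le_iff_of_nonneg hc).2 fun k => ?_
    refine le_trans ?_ (hy k)
    rw [← norm_abs_eq_norm (y k)]
    exact norm_le_of_le (posPart_nonneg _) (sup_le (le_abs_self _) (abs_nonneg _))
  have hsingle_le : ∀ k y, f (Pi.single k y) ≤ D * ‖y‖ := fun k y =>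
    hpos_le _ _ (norm_nonneg y) fun j => by
      rcases eq_or_ne j k with rfl | hjk
      · simp
      · simp [hjk]
  set φ : Fin m → StrongDual ℝ X := fun k =>
    (f ∘ₗ LinearMap.single ℝ (fun _ : Fin m => X) k).mkContinuous D fun y => by
      refine abs_le.2 ⟨?_, hsingle_le k y⟩
      have := hsingle_le k (-y)
      rw [Pi.single_neg, map_neg, norm_neg] at this
      exact neg_le.1 this with hφ
  have hsum : ∀ y : Fin m → X, f y = ∑ k, φ k (y k) := by
    intro y
    conv_lhs => rw [← Finset.univ_sum_single y, map_sum]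
    rfl
  refine ⟨φ, fun k y hy => ?_, ?_, fun i x hx => ?_⟩
  -- The sublinear bound vanishes at negative elements, which makes `φ k` positive.
  · have h1 := hf (-Pi.single k y)
    have h2 : (fun j => ((-Pi.single k y : Fin m → X) j)⁺) = 0 := by
      funext j
      rcases eq_or_ne j k with rfl | hjk
      · simpa using hy
      · simp [hjk]
    rw [h2, norm_zero, mul_zero, map_neg] at h1
    simpa [hφ] using h1
  -- `∑ ‖φ k‖` is the `ℓ_1` norm, hence determined by sequences `y` with `max ‖y k‖ ≤ 1`.
  · have h := ENNReal.HolderConjugate.top_one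
    rw [← strongNorm_one]
    refine strongNorm_dual_le_of_forall h fun y hy => ?_
    rw [← hsum]
    simpa using hpos_le y 1 zero_le_one fun k => (norm_le_strongNorm h.one_le y k).trans hy
  -- Domination of `g i` is the cone inequality at the sequence with single entry `x`.
  · have h1 := hfg (Pi.single i x) <| by
      have : (0 : Fin n → X) ≤ Pi.single i x := Pi.single_nonneg.2 hx
      simpa using this
    rw [hsum] at h1
    have h2 : ∀ k, ∑ j, a k j • (Pi.single i x : Fin n → X) j = a k i • x := fun k => by
      rw [Finset.sum_eq_single i] <;> simp +contextual
    have h3 : ∑ j, g j ((Pi.single i x : Fin n → X) j) = g i x := by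
      rw [Finset.sum_eq_single i] <;> simp +contextual
    simpa [h2, h3] using h1

/-- A bound for `x ↦ ∑ g i (x i)` on the cone of `X ^ n` by the norm of `ℓ_{q,|ω|}(X)` passes to
the cone of the bidual. -/
lemma sum_bidual_apply_le (h : q.HolderConjugate r) {g : Fin n → StrongDual ℝ X} {C : ℝ}
    (hC : 0 ≤ C)
    (hg : ∀ x : Fin n → X, (∀ i, 0 ≤ x i) → ∑ i, g i (x i) ≤ C * absWeakNorm q x)
    {Φ : Fin n → StrongDual ℝ (StrongDual ℝ X)} (hΦ : ∀ i, 0 ≤ Φ i) :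
    ∑ i, Φ i (g i) ≤ C * absWeakNorm q Φ := by
  have hW := absWeakNorm_nonneg h.one_le Φ
  have key : ∀ ε : ℝ, 0 < ε → ε < 1 → ∑ i, Φ i (g i) ≤ C * (1 - ε)⁻¹ * absWeakNorm q Φ := by
    intro ε hε hε1
    have hε' : 0 < 1 - ε := by linarith
    obtain ⟨m, a, ha, ha1, hnorming⟩ := exists_finite_norming h n hε
    obtain ⟨φ, hφ, hφD, hgφ⟩ := exists_dominating_dual (a := a) (g := g)
      (D := C * (1 - ε)⁻¹) (by positivity) fun x hx => by
        refine (hg x hx).trans ?_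
        rw [mul_assoc]
        refine mul_le_mul_of_nonneg_left (absWeakNorm_le fun ψ hψ hψ1 => ?_) hC
        obtain ⟨k, hk⟩ := hnorming (fun i => ψ |x i|) fun i =>
          dual_apply_nonneg hψ (abs_nonneg (x i))
        rw [le_inv_mul_iff₀ hε']
        refine hk.trans ?_
        have h1 : ∑ i, a k i * ψ |x i| = ψ (∑ i, a k i • x i) := by
          simp [abs_of_nonneg (hx _)]
        rw [h1]
        refine (dual_apply_mono hψ (le_posPart (∑ i, a k i • x i))).trans ?_
        refine (le_abs_self _).trans ((ψ.le_of_opNorm_le hψ1 _).trans ?_)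
        rw [one_mul]
        exact norm_le_pi_norm (fun k => (∑ i, a k i • x i)⁺) k
    calc ∑ i, Φ i (g i) ≤ ∑ i, Φ i (∑ k, a k i • φ k) :=
          Finset.sum_le_sum fun i _ => dual_apply_mono (hΦ i) (hgφ i)
      _ = ∑ k, ∑ i, a k i * Φ i (φ k) := by
          simp only [map_sum, map_smul, smul_eq_mul]
          exact Finset.sum_comm
      _ ≤ ∑ k, ‖φ k‖ * absWeakNorm q Φ := by
          refine Finset.sum_le_sum fun k _ => ?_
          have h1 := sum_norm_mul_norm_le h (a k) fun i => Φ i (φ k)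
          simp only [Real.norm_of_nonneg (ha k _),
            Real.norm_of_nonneg (dual_apply_nonneg (hΦ _) (hφ k))] at h1
          refine h1.trans ((mul_le_of_le_one_left (strongNorm_nonneg h.one_le _) (ha1 k)).trans ?_)
          exact strongNorm_dual_apply_le h.one_le hΦ (hφ k)
      _ ≤ _ := by
          rw [← Finset.sum_mul]
          exact mul_le_mul_of_nonneg_right hφD hW
  -- Let `ε` tend to `0`; explicitly, `ε = (s - w) / (2 s)` contradicts `w < s`.
  set s := ∑ i, Φ i (g i)
  set w := C * absWeakNorm q Φ
  have hw : 0 ≤ w := mul_nonneg hC hW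
  by_contra! hlt
  have hs : 0 < s := hw.trans_lt hlt
  have hε : 0 < (s - w) / (2 * s) := div_pos (by linarith) (by linarith)
  have hε1 : (s - w) / (2 * s) < 1 := by rw [div_lt_one (by linarith)]; linarith
  have h1 := key _ hε hε1
  rw [mul_right_comm, ← div_eq_mul_inv, le_div_iff₀ (by linarith)] at h1
  have h2 : s * (1 - (s - w) / (2 * s)) = (s + w) / 2 := by
    field_simp
    ring
  rw [h2] at h1
  change _ ≤ w at h1
  linarith

/-- The version of `sum_bidual_apply_le` with absolute values, by changing the signs of the
`g i`. -/
lemma sum_abs_bidual_apply_le (h : q.HolderConjugate r) {g : Fin n → StrongDual ℝ X} {C : ℝ}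
    (hC : 0 ≤ C)
    (hg : ∀ x : Fin n → X, (∀ i, 0 ≤ x i) → ∑ i, |g i (x i)| ≤ C * absWeakNorm q x)
    {Φ : Fin n → StrongDual ℝ (StrongDual ℝ X)} (hΦ : ∀ i, 0 ≤ Φ i) :
    ∑ i, |Φ i (g i)| ≤ C * absWeakNorm q Φ := by
  have hsign : ∀ t : ℝ, ∃ ε : ℝ, |ε| = 1 ∧ ε * t = |t| := fun t => by
    rcases le_total 0 t with ht | ht
    · exact ⟨1, by simp, by simp [abs_of_nonneg ht]⟩
    · exact ⟨-1, by simp, by simp [abs_of_nonpos ht]⟩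
  choose ε hε hεt using fun i => hsign (Φ i (g i))
  have := sum_bidual_apply_le h (g := fun i => ε i • g i) hC (fun x hx => by
    refine le_trans (Finset.sum_le_sum fun i _ => ?_) (hg x hx)
    refine (le_abs_self _).trans (le_of_eq ?_)
    simp [abs_mul, hε]) hΦ
  simpa [hεt] using this

end Bidual

/-! ### Operators and their adjoints -/

section Duality

variable {X : Type*} [NormedAddCommGroup X] [Lattice X] [IsOrderedAddMonoid X]
  [NormedSpace ℝ X] [IsOrderedModule ℝ X] [HasSolidNorm X]
  {F : Type*} [NormedAddCommGroup F] [NormedSpace ℝ F] {p q p' q' : ℝ≥0∞} {C : ℝ}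

lemma PosSummingWith.onCone {T : X →L[ℝ] F} (hT : PosSummingWith p q T C) :
    PosSummingOnConeWith p q T C := fun n x _ => hT n x

lemma PosSummingOnConeWith.posSummingWith (hp : 1 ≤ p) (hq : 1 ≤ q) (hC : 0 ≤ C) {T : X →L[ℝ] F}
    (hT : PosSummingOnConeWith p q T C) : PosSummingWith p q T (2 * C) := by
  intro n x
  have hp' : ∀ i, |(x i)⁺| ≤ |x i| := fun i => by
    rw [abs_of_nonneg (posPart_nonneg _)]
    exact sup_le (le_abs_self _) (abs_nonneg _)
  have hn' : ∀ i, |(x i)⁻| ≤ |x i| := fun i => by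
    rw [abs_of_nonneg (negPart_nonneg _)]
    exact sup_le (neg_le_abs _) (abs_nonneg _)
  have h1 := (hT n (fun i => (x i)⁺) fun i => posPart_nonneg _).trans
    (mul_le_mul_of_nonneg_left (absWeakNorm_mono hq hp') hC)
  have h2 := (hT n (fun i => (x i)⁻) fun i => negPart_nonneg _).trans
    (mul_le_mul_of_nonneg_left (absWeakNorm_mono hq hn') hC)
  have h3 := strongNorm_sub_le hp (fun i => T (x i)⁺) fun i => T (x i)⁻
  simp only [← map_sub, posPart_sub_negPart] at h3
  linarith

lemma isPosSumming_iff_exists_onCone (hp : 1 ≤ p) (hq : 1 ≤ q) {T : X →L[ℝ] F} :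
    IsPosSumming p q T ↔ ∃ C : ℝ, 0 < C ∧ PosSummingOnConeWith p q T C :=
  ⟨fun ⟨C, hC, hT⟩ => ⟨C, hC, hT.onCone⟩,
    fun ⟨C, hC, hT⟩ => ⟨2 * C, by positivity, hT.posSummingWith hp hq hC.le⟩⟩

lemma posSummingWith_iff_piBoundedWith_dual (hp : p.HolderConjugate p')
    (hq : q.HolderConjugate q') (hC : 0 ≤ C) (T : X →L[ℝ] F) :
    PosSummingWith p q T C ↔ PiBoundedWith q' p' (dualOperator T) C := by
  have hq'q : q'.conjExponent = q := hq.symm.conjExponent_eq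
  constructor
  · intro hT n f
    have hf := strongNorm_nonneg hp.symm.one_le f
    refine piNorm_le hq'q hq.one_le fun Φ hΦ hΦ1 => ?_
    refine (sum_bidual_apply_le hq (C := C * strongNorm p' f) (mul_nonneg hC hf) (fun x hx => ?_)
      hΦ).trans (mul_le_of_le_one_right (mul_nonneg hC hf) hΦ1)
    -- `|T* f i| (x i)` is a supremum of `f i (T (z i))` over `|z i| ≤ x i`.
    refine sum_abs_dual_apply_le hx fun z hz => ?_
    have hzx : absWeakNorm q z ≤ absWeakNorm q x :=
      absWeakNorm_mono hq.one_le fun i => by rw [abs_of_nonneg (hx i)]; exact hz i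
    calc ∑ i, dualOperator T (f i) (z i) ≤ ∑ i, |f i (T (z i))| :=
          Finset.sum_le_sum fun i _ => le_abs_self _
      _ ≤ strongNorm p' f * strongNorm p fun i => T (z i) := sum_abs_apply_le hp _ _
      _ ≤ strongNorm p' f * (C * absWeakNorm q x) := by
          refine mul_le_mul_of_nonneg_left ((hT n z).trans ?_) hf
          exact mul_le_mul_of_nonneg_left hzx hC
      _ = _ := by ring
  · intro hT n x
    have hW := absWeakNorm_nonneg hq.one_le x
    refine strongNorm_le_of_forall_dual hp fun f hf => ?_
    have h1 := sum_apply_le_absWeakNorm_mul_piNorm hq'q hq.one_le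
      (fun i => dualOperator T (f i)) fun i => inclusionInDoubleDual_nonneg (abs_nonneg (x i))
    have h2 : absWeakNorm q (fun i => NormedSpace.inclusionInDoubleDual ℝ X |x i|) ≤
        absWeakNorm q x :=
      (absWeakNorm_inclusionInDoubleDual_le hq.one_le fun i => abs_nonneg (x i)).trans
        (absWeakNorm_mono hq.one_le fun i => (abs_abs _).le)
    have h3 : piNorm q' (fun i => dualOperator T (f i)) ≤ C :=
      (hT n f).trans (mul_le_of_le_one_right hC hf)
    calc ∑ i, f i (T (x i)) ≤ ∑ i, |dualOperator T (f i)| |x i| :=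
          Finset.sum_le_sum fun i _ =>
            (le_abs_self _).trans (abs_apply_le_abs (dualOperator T (f i)) (x i))
      _ ≤ _ := h1
      _ ≤ absWeakNorm q (fun i => NormedSpace.inclusionInDoubleDual ℝ X |x i|) * C :=
          mul_le_mul_of_nonneg_left h3 (absWeakNorm_nonneg hq.one_le _)
      _ ≤ absWeakNorm q x * C := mul_le_mul_of_nonneg_right h2 hC
      _ = _ := mul_comm _ _

lemma posSummingOnConeWith_iff_posStronglySummingWith_dual (hp : p.HolderConjugate p')
    (hq : q.HolderConjugate q') (hC : 0 ≤ C) (T : X →L[ℝ] F) :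
    PosSummingOnConeWith p q T C ↔ PosStronglySummingWith q' p' (dualOperator T) C := by
  have hq'q : q'.conjExponent = q := hq.symm.conjExponent_eq
  constructor
  · intro hT n f Φ hΦ
    have hf := strongNorm_nonneg hp.symm.one_le f
    rw [hq'q, weakNorm_eq_absWeakNorm hq.one_le hΦ]
    refine sum_abs_bidual_apply_le hq (mul_nonneg hC hf) (fun x hx => ?_) hΦ
    refine (sum_abs_apply_le hp f fun i => T (x i)).trans ?_
    rw [mul_comm C, mul_assoc]
    exact mul_le_mul_of_nonneg_left (hT n x hx) hf
  · intro hT n x hx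
    refine strongNorm_le_of_forall_dual hp fun f hf => ?_
    have hJ := fun i => inclusionInDoubleDual_nonneg (hx i)
    have h1 := hT n f (fun i => NormedSpace.inclusionInDoubleDual ℝ X (x i)) hJ
    rw [hq'q, weakNorm_eq_absWeakNorm hq.one_le hJ] at h1
    calc ∑ i, f i (T (x i)) ≤ ∑ i, |f i (T (x i))| := Finset.sum_le_sum fun i _ => le_abs_self _
      _ ≤ _ := h1
      _ ≤ C * 1 * absWeakNorm q x := by
          gcongr
          · exact absWeakNorm_nonneg hq.one_le _
          · exact absWeakNorm_inclusionInDoubleDual_le hq.one_le hx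
      _ = _ := by rw [mul_one]

lemma piBoundedWith_iff_posSummingWith_dual (hp : p.HolderConjugate p')
    (hq : q.HolderConjugate q') (hC : 0 ≤ C) (T : F →L[ℝ] X) :
    PiBoundedWith p q T C ↔ PosSummingWith q' p' (dualOperator T) C := by
  have hpp' : p.conjExponent = p' := hp.conjExponent_eq
  constructor
  · intro hT n φ
    have hW := absWeakNorm_nonneg hp.symm.one_le φ
    refine strongNorm_dual_le_of_forall hq fun x hx => ?_
    have h1 := sum_apply_le_absWeakNorm_mul_piNorm hpp' hp.symm.one_le (fun i => T (x i))
      fun i => abs_nonneg (φ i)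
    have h2 : absWeakNorm p' (fun i => |φ i|) ≤ absWeakNorm p' φ :=
      absWeakNorm_mono hp.symm.one_le fun i => (abs_abs _).le
    calc ∑ i, dualOperator T (φ i) (x i) ≤ ∑ i, |φ i| |T (x i)| :=
          Finset.sum_le_sum fun i _ => (le_abs_self _).trans (abs_apply_le_abs (φ i) (T (x i)))
      _ ≤ _ := h1
      _ ≤ absWeakNorm p' (fun i => |φ i|) * C :=
          mul_le_mul_of_nonneg_left ((hT n x).trans (mul_le_of_le_one_right hC hx))
            (absWeakNorm_nonneg hp.symm.one_le _)
      _ ≤ absWeakNorm p' φ * C := mul_le_mul_of_nonneg_right h2 hC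
      _ = _ := mul_comm _ _
  · intro hT n x
    have hx := strongNorm_nonneg hq.one_le x
    refine piNorm_le hpp' hp.symm.one_le fun φ hφ hφ1 => ?_
    choose ψ hψφ hψ using fun i => exists_abs_le_apply_eq (hφ i) (T (x i))
    have h1 : absWeakNorm p' ψ ≤ 1 := (absWeakNorm_mono hp.symm.one_le fun i => by
      rw [abs_of_nonneg (hφ i)]; exact hψφ i).trans hφ1
    calc ∑ i, φ i |T (x i)| ≤ ∑ i, |dualOperator T (ψ i) (x i)| :=
          Finset.sum_le_sum fun i _ => (hψ i).trans (le_abs_self _)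
      _ ≤ strongNorm q' (fun i => dualOperator T (ψ i)) * strongNorm q x :=
          sum_abs_apply_le hq _ _
      _ ≤ C * strongNorm q x :=
          mul_le_mul_of_nonneg_right ((hT n ψ).trans (mul_le_of_le_one_right hC h1)) hx

lemma posStronglySummingWith_iff_posSummingOnConeWith_dual (hp : p.HolderConjugate p')
    (hq : q.HolderConjugate q') (hC : 0 ≤ C) (T : F →L[ℝ] X) :
    PosStronglySummingWith p q T C ↔ PosSummingOnConeWith q' p' (dualOperator T) C := by
  have hpp' : p.conjExponent = p' := hp.conjExponent_eq
  constructor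
  · intro hT n φ hφ
    refine strongNorm_dual_le_of_forall hq fun x hx => ?_
    have h1 := hT n x φ hφ
    rw [hpp', weakNorm_eq_absWeakNorm hp.symm.one_le hφ] at h1
    calc ∑ i, dualOperator T (φ i) (x i) ≤ ∑ i, |φ i (T (x i))| :=
          Finset.sum_le_sum fun i _ => le_abs_self _
      _ ≤ _ := h1
      _ ≤ C * absWeakNorm p' φ :=
          mul_le_mul_of_nonneg_right (mul_le_of_le_one_right hC hx)
            (absWeakNorm_nonneg hp.symm.one_le φ)
  · intro hT n x φ hφ
    rw [hpp', weakNorm_eq_absWeakNorm hp.symm.one_le hφ, mul_right_comm]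
    exact (sum_abs_apply_le hq (fun i => dualOperator T (φ i)) x).trans
      (mul_le_mul_of_nonneg_right (hT n φ hφ) (strongNorm_nonneg hq.one_le x))

end Duality

lemma leastConstant_congr {P Q : ℝ → Prop} (h : ∀ C, 0 < C → (P C ↔ Q C)) :
    leastConstant P = leastConstant Q :=
  iInf_congr fun C => iInf_congr_Prop (and_congr_right (h C)) fun _ => rfl

end

theorem mainTheorem4 {X : Type*} [NormedAddCommGroup X] [Lattice X] [IsOrderedAddMonoid X]
    [NormedSpace ℝ X] [IsOrderedModule ℝ X] [HasSolidNorm X] [CompleteSpace X]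
    {F : Type*} [NormedAddCommGroup F] [NormedSpace ℝ F] [CompleteSpace F]
    {E : Type*} [NormedAddCommGroup E] [NormedSpace ℝ E] [CompleteSpace E]
    {Y : Type*} [NormedAddCommGroup Y] [Lattice Y] [IsOrderedAddMonoid Y]
    [NormedSpace ℝ Y] [IsOrderedModule ℝ Y] [HasSolidNorm Y] [CompleteSpace Y]
    (p q : ℝ≥0∞) (hq : 1 ≤ q) (hqp : q ≤ p) :
    (∀ T : X →L[ℝ] F,
      (IsPosSumming p q T ↔
        IsPosStronglySumming q.conjExponent p.conjExponent (dualOperator T)) ∧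
      posSummingNorm p q T =
        posStronglySummingPiNorm q.conjExponent p.conjExponent (dualOperator T) ∧
      posSummingConeNorm p q T =
        posStronglySummingNorm q.conjExponent p.conjExponent (dualOperator T)) ∧
    (∀ T : E →L[ℝ] Y,
      (IsPosStronglySumming p q T ↔
        IsPosSumming q.conjExponent p.conjExponent (dualOperator T)) ∧
      posStronglySummingPiNorm p q T =
        posSummingNorm q.conjExponent p.conjExponent (dualOperator T) ∧
      posStronglySummingNorm p q T =
        posSummingConeNorm q.conjExponent p.conjExponent (dualOperator T)) := by
  have hp := ENNReal.HolderConjugate.conjExponent (hq.trans hqp)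
  have hq := ENNReal.HolderConjugate.conjExponent hq
  refine ⟨fun T => ⟨?_, ?_, ?_⟩, fun T => ⟨?_, ?_, ?_⟩⟩
  · exact (isPosSumming_iff_exists_onCone hp.one_le hq.one_le).trans <| exists_congr fun C =>
      and_congr_right fun hC =>
        posSummingOnConeWith_iff_posStronglySummingWith_dual hp hq hC.le T
  · exact leastConstant_congr fun C hC => posSummingWith_iff_piBoundedWith_dual hp hq hC.le T
  · exact leastConstant_congr fun C hC =>
      posSummingOnConeWith_iff_posStronglySummingWith_dual hp hq hC.le T
  · exact Iff.trans (exists_congr fun C => and_congr_right fun hC =>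
      posStronglySummingWith_iff_posSummingOnConeWith_dual hp hq hC.le T)
      (isPosSumming_iff_exists_onCone hq.symm.one_le hp.symm.one_le).symm
  · exact leastConstant_congr fun C hC => piBoundedWith_iff_posSummingWith_dual hp hq hC.le T
  · exact leastConstant_congr fun C hC =>
      posStronglySummingWith_iff_posSummingOnConeWith_dual hp hq hC.le T
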